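/- All graphs are finite and simple. For a set $\mathcal F$ of subgraphs of a graph $G$, let $G-\mathcal F$ be the graph obtained from $G$ by deleting all vertices of all members of $\mathcal F$; $\mathcal F$ is a subgraph cut of $G$ if $G-\mathcal F$ is disconnected or has exactly one vertex. For a connected graph $H$, the $H$-structure connectivity $\kappa(G;H)$ (resp. the $H$-substructure connectivity $\kappa^s(G;H)$) is the minimum of $|\mathcal F|$ over all subgraph cuts $\mathcal F$ of $G$ each of whose members is isomorphic to $H$ (resp. to a connected subgraph of $H$). The crossed cube $CQ_n$ has as vertices the binary strings $x_{n-1}\cdots x_0$. $CQ_1=K_2$. For $n\ge2$, $CQ_n$ consists of two copies of $CQ_{n-1}$, whose vertices are prefixed with $0$ and with $1$ respectively, and the edges joining $0u_{n-2}\cdots u_0$ to $1v_{n-2}\cdots v_0$ exactly when (i) $u_{n-2}=v_{n-2}$ if $n$ is even, and (ii) for all $0\le i<\lfloor (n-1)/2\rfloor$ the pair $(u_{2i+1}u_{2i},\,v_{2i+1}v_{2i})$ is one of $(00,00),(10,10),(01,11),(11,01)$. The BCDC network $B_n$, $n\ge2$, has as vertices certain unordered pairs $[x,y]$ of binary strings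 of length $n$. $B_2$ is the $4$-cycle $[00,01],[00,10],[10,11],[01,11]$. For $n\ge3$, $B_n$ consists of two copies $B^0_{n-1}$, $B^1_{n-1}$ of $B_{n-1}$, in which both strings of every vertex are prefixed with $0$ and with $1$ respectively, together with an independent set $S_n$ of new vertices, namely the pairs $[c,d]$ such that $c$ begins with $0$, $d$ begins with $1$ and $cd$ is an edge of $CQ_n$; the vertex $[c,d]\in S_n$ is adjacent to exactly those vertices of $B^0_{n-1}$ that contain $c$ and those vertices of $B^1_{n-1}$ that contain $d$. (Equivalently, $B_n$ is the line graph of $CQ_n$.) Theorem 4.5. Let $K_{1,1}$ be the complete graph on two vertices. Then $$\kappa(B_n;K_{1,1})=\kappa^s(B_n;K_{1,1})=\begin{cases} n-1, & n\ge5 \text{ odd},\\ n, & n\ge4\text{ even}.\end{cases}$$ -/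

import Mathlib

/-! ### Structure and substructure connectivity -/

/-- The set `V(𝓕)` of all vertices covered by a set `𝓕` of subgraphs of `G`. -/
def coveredVerts {V : Type*} {G : SimpleGraph V} (F : Set G.Subgraph) : Set V :=
  ⋃ K ∈ F, K.verts

/-- `𝓕` is a subgraph cut of `G`: deleting all vertices of its members from `G` leaves a
disconnected graph or a graph with exactly one vertex. (The empty graph is `Preconnected`, so
deleting every vertex does not count as disconnecting.) -/
def IsSubgraphCut {V : Type*} (G : SimpleGraph V) (F : Set G.Subgraph) : Prop :=
  ¬ (G.induce (coveredVerts F)ᶜ).Preconnected ∨ ∃ v, (coveredVerts F)ᶜ = {v}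

/-- `𝓕` is an `H`-structure cut of `G`: a subgraph cut all of whose members are isomorphic
to `H`. -/
def IsStructureCut {V W : Type*} (G : SimpleGraph V) (H : SimpleGraph W)
    (F : Set G.Subgraph) : Prop :=
  IsSubgraphCut G F ∧ ∀ K ∈ F, Nonempty (K.coe ≃g H)

/-- `𝓕` is an `H`-substructure cut of `G`: a subgraph cut all of whose members are isomorphic
to connected subgraphs of `H`. -/
def IsSubstructureCut {V W : Type*} (G : SimpleGraph V) (H : SimpleGraph W)
    (F : Set G.Subgraph) : Prop :=
  IsSubgraphCut G F ∧ ∀ K ∈ F, ∃ H' : H.Subgraph, H'.Connected ∧ Nonempty (K.coe ≃g H'.coe)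

/-- The `H`-structure connectivity `κ(G; H)`: the least size of an `H`-structure cut of `G`
(`⊤` if there is none). -/
noncomputable def structureConnectivity {V W : Type*} (G : SimpleGraph V)
    (H : SimpleGraph W) : ℕ∞ :=
  sInf {k | ∃ F : Set G.Subgraph, IsStructureCut G H F ∧ F.encard = k}

/-- The `H`-substructure connectivity `κˢ(G; H)`: the least size of an `H`-substructure cut
of `G` (`⊤` if there is none). -/
noncomputable def substructureConnectivity {V W : Type*} (G : SimpleGraph V)
    (H : SimpleGraph W) : ℕ∞ :=
  sInf {k | ∃ F : Set G.Subgraph, IsSubstructureCut G H F ∧ F.encard = k}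

/-! ### Crossed cubes -/

/-- Binary strings `x_{n-1} … x_1 x_0`; the entry `x_i` is the value at `i`. -/
abbrev BinString (n : ℕ) : Type := Fin n → Bool

/-- Prefix the string `x_{n-1} … x_0` with the bit `b`, which becomes the entry `x_n`. -/
def BinString.cons {n : ℕ} (b : Bool) (x : BinString n) : BinString (n + 1) :=
  Fin.snoc (α := fun _ => Bool) x b

/-- `PairRelated x₁ x₀ y₁ y₀` says that the strings `x₁x₀` and `y₁y₀` are pair related. -/
def PairRelated (x₁ x₀ y₁ y₀ : Bool) : Prop :=
  ((x₁, x₀), (y₁, y₀)) ∈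
    ({((false, false), (false, false)), ((true, false), (true, false)),
      ((false, true), (true, true)), ((true, true), (false, true))} :
      Set ((Bool × Bool) × (Bool × Bool)))

/-- For strings `u`, `v` of length `m`: the condition under which `0u` and `1v` are joined in
the crossed cube of dimension `n = m + 1`. If `n` is even, then the leading bits of `u` and `v`
agree; and `u_{2i+1}u_{2i} ∼ v_{2i+1}v_{2i}` for all `i < ⌊m / 2⌋`, that is `2i + 1 < m`. -/
def CrossRelated {m : ℕ} (u v : BinString m) : Prop :=
  (Even (m + 1) → ∀ i : Fin m, i.val + 1 = m → u i = v i) ∧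
  ∀ (i : ℕ) (h : 2 * i + 1 < m),
    PairRelated (u ⟨2 * i + 1, h⟩) (u ⟨2 * i, Nat.lt_of_succ_lt h⟩)
      (v ⟨2 * i + 1, h⟩) (v ⟨2 * i, Nat.lt_of_succ_lt h⟩)

/-- The crossed cube `CQ_n`: `CQ_1 = K_2`, and for `n ≥ 2` it consists of the copies `0CQ_{n-1}`
and `1CQ_{n-1}` together with the edges joining `0u` and `1v` for cross-related `u`, `v`.
(`CQ_0` is a placeholder.) -/
def crossedCube : (n : ℕ) → SimpleGraph (BinString n)
  | 0 => ⊥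
  | 1 => ⊤
  | n + 2 => SimpleGraph.fromRel fun x y : BinString (n + 2) =>
      (∃ b u v, x = BinString.cons b u ∧ y = BinString.cons b v ∧ (crossedCube (n + 1)).Adj u v) ∨
      (∃ u v, x = BinString.cons false u ∧ y = BinString.cons true v ∧ CrossRelated u v)

/-! ### BCDC networks -/

/-- Prefix a server `[x, y]` with the bit `b`, giving `[bx, by]`. -/
def serverCons {n : ℕ} (b : Bool) (e : Sym2 (BinString n)) : Sym2 (BinString (n + 1)) :=
  e.map (BinString.cons b)

/-- The two-bit string `ab`. -/
def twoBits (a b : Bool) : BinString 2 := ![b, a]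

/-- The set `S_n` of servers `[a, b]` with `a` in `0CQ_{n-1}`, `b` in `1CQ_{n-1}` and `ab` an edge
of `CQ_n`, where `n = m + 1`. -/
def crossServers (m : ℕ) : Set (Sym2 (BinString (m + 1))) :=
  {e | ∃ u v : BinString m, e = s(BinString.cons false u, BinString.cons true v) ∧
    (crossedCube (m + 1)).Adj (BinString.cons false u) (BinString.cons true v)}

/-- The vertex set of `B_n`, for `n ≥ 2`; its elements are unordered pairs `[x, y]` of strings. -/
def bcdcServers : (n : ℕ) → Set (Sym2 (BinString n))
  | 0 => ∅
  | 1 => ∅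
  | 2 => {s(twoBits false false, twoBits false true), s(twoBits false false, twoBits true false),
      s(twoBits false true, twoBits true true), s(twoBits true false, twoBits true true)}
  | n + 3 => serverCons false '' bcdcServers (n + 2) ∪ serverCons true '' bcdcServers (n + 2) ∪
      crossServers (n + 2)

/-- The edges of `B_n`, for `n ≥ 2`, as a graph on all unordered pairs of strings. `B_2` is the
4-cycle `[00,01], [00,10], [10,11], [01,11]`. For `n ≥ 3`, `B_n` has the edges of `0B_{n-1}` and
of `1B_{n-1}`, and a server `[c, d]` of `S_n`, with `c` in `0CQ_{n-1}` and `d` in `1CQ_{n-1}`, is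
adjacent to the servers of `0B_{n-1}` that contain `c` and to those of `1B_{n-1}` that
contain `d`. -/
def bcdcLinks : (n : ℕ) → SimpleGraph (Sym2 (BinString n))
  | 0 => ⊥
  | 1 => ⊥
  | 2 => SimpleGraph.fromEdgeSet
      {s(s(twoBits false false, twoBits false true), s(twoBits false false, twoBits true false)),
       s(s(twoBits false false, twoBits true false), s(twoBits true false, twoBits true true)),
       s(s(twoBits true false, twoBits true true), s(twoBits false true, twoBits true true)),
       s(s(twoBits false true, twoBits true true), s(twoBits false false, twoBits false true))}
  | n + 3 => SimpleGraph.fromRel fun e f : Sym2 (BinString (n + 3)) =>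
      (∃ b e' f', e = serverCons b e' ∧ f = serverCons b f' ∧ (bcdcLinks (n + 2)).Adj e' f') ∨
      (∃ c d : BinString (n + 2),
        f = s(BinString.cons false c, BinString.cons true d) ∧ f ∈ crossServers (n + 2) ∧
        ((e ∈ serverCons false '' bcdcServers (n + 2) ∧ BinString.cons false c ∈ e) ∨
         (e ∈ serverCons true '' bcdcServers (n + 2) ∧ BinString.cons true d ∈ e)))

/-- The BCDC network `B_n`, for `n ≥ 2`. -/
def bcdc (n : ℕ) : SimpleGraph (bcdcServers n) :=
  (bcdcLinks n).induce (bcdcServers n)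

/-! ### `B_n` is the line graph of `CQ_n` -/

theorem BinString.cons_inj {n : ℕ} {b c : Bool} {x y : BinString n} :
    BinString.cons b x = BinString.cons c y ↔ b = c ∧ x = y := by
  unfold BinString.cons
  rw [Fin.snoc_inj]; tauto

theorem BinString.exists_cons {n : ℕ} (x : BinString (n + 1)) :
    ∃ b u, x = BinString.cons b u :=
  ⟨x (Fin.last n), Fin.init x, (Fin.snoc_init_self (α := fun _ => Bool) x).symm⟩

theorem PairRelated.symm {a b c d : Bool} (h : PairRelated a b c d) : PairRelated c d a b := by
  revert h; unfold PairRelated; cases a <;> cases b <;> cases c <;> cases d <;> simp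

theorem PairRelated.unique {a b c d c' d' : Bool} (h : PairRelated a b c d)
    (h' : PairRelated a b c' d') : c = c' ∧ d = d' := by
  revert h h'; unfold PairRelated
  cases a <;> cases b <;> cases c <;> cases d <;> cases c' <;> cases d' <;> simp

theorem CrossRelated.symm {m : ℕ} {u v : BinString m} (h : CrossRelated u v) :
    CrossRelated v u :=
  ⟨fun he i hi => (h.1 he i hi).symm, fun i hi => (h.2 i hi).symm⟩

theorem CrossRelated.unique {m : ℕ} {u v w : BinString m} (h : CrossRelated u v)
    (h' : CrossRelated u w) : v = w := by
  funext j
  obtain ⟨j, hj⟩ := j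
  rcases Nat.even_or_odd' j with ⟨i, rfl | rfl⟩
  · by_cases hi : 2 * i + 1 < m
    · exact ((h.2 i hi).unique (h'.2 i hi)).2
    · have hm : 2 * i + 1 = m := by omega
      have he : Even (m + 1) := ⟨i + 1, by omega⟩
      rw [← h.1 he ⟨2 * i, hj⟩ hm, ← h'.1 he ⟨2 * i, hj⟩ hm]
  · exact ((h.2 i hj).unique (h'.2 i hj)).1

theorem crossedCube_adj_same {n : ℕ} (b : Bool) (u v : BinString (n + 1)) :
    (crossedCube (n + 2)).Adj (BinString.cons b u) (BinString.cons b v) ↔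
      (crossedCube (n + 1)).Adj u v := by
  simp only [crossedCube, SimpleGraph.fromRel_adj, ne_eq, BinString.cons_inj]
  constructor
  · rintro ⟨-, (⟨c, x, y, ⟨-, rfl⟩, ⟨-, rfl⟩, h⟩ | ⟨x, y, ⟨rfl, -⟩, ⟨h, -⟩, -⟩) |
      (⟨c, x, y, ⟨-, rfl⟩, ⟨-, rfl⟩, h⟩ | ⟨x, y, ⟨rfl, -⟩, ⟨h, -⟩, -⟩)⟩
    · exact h
    · cases h
    · exact h.symm
    · cases h
  · intro h
    exact ⟨fun h' => h.ne h'.2, Or.inl (Or.inl ⟨b, u, v, by simp, by simp, h⟩)⟩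

theorem crossedCube_adj_cross {n : ℕ} (u v : BinString (n + 1)) :
    (crossedCube (n + 2)).Adj (BinString.cons false u) (BinString.cons true v) ↔
      CrossRelated u v := by
  simp only [crossedCube, SimpleGraph.fromRel_adj, ne_eq, BinString.cons_inj]
  constructor
  · rintro ⟨-, (⟨c, x, y, ⟨rfl, -⟩, ⟨h, -⟩, -⟩ | ⟨x, y, ⟨-, rfl⟩, ⟨-, rfl⟩, h⟩) |
      (⟨c, x, y, ⟨rfl, -⟩, ⟨h, -⟩, -⟩ | ⟨x, y, ⟨h, -⟩, -, -⟩)⟩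
    · cases h
    · exact h
    · cases h
    · cases h
  · intro h
    exact ⟨by simp, Or.inl (Or.inr ⟨u, v, by simp, by simp, h⟩)⟩

theorem mem_serverCons {n : ℕ} {b : Bool} {e : Sym2 (BinString n)} {x : BinString (n + 1)} :
    x ∈ serverCons b e ↔ ∃ u ∈ e, x = BinString.cons b u := by
  simp only [serverCons, Sym2.mem_map, eq_comm]

theorem serverCons_injective {n : ℕ} (b : Bool) :
    Function.Injective (serverCons (n := n) b) :=
  Sym2.map.injective fun _ _ h => (BinString.cons_inj.1 h).2

theorem cons_mem_serverCons {n : ℕ} {b c : Bool} {e : Sym2 (BinString n)} {x : BinString n} :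
    BinString.cons c x ∈ serverCons b e ↔ c = b ∧ x ∈ e := by
  rw [mem_serverCons]
  constructor
  · rintro ⟨u, hu, h⟩
    obtain ⟨rfl, rfl⟩ := BinString.cons_inj.1 h
    exact ⟨rfl, hu⟩
  · rintro ⟨rfl, h⟩
    exact ⟨x, h, rfl⟩

theorem serverCons_inj {n : ℕ} {b c : Bool} {e f : Sym2 (BinString n)} :
    serverCons b e = serverCons c f ↔ b = c ∧ e = f := by
  constructor
  · intro h
    have hx : BinString.cons b e.out.1 ∈ serverCons c f :=
      h ▸ cons_mem_serverCons.2 ⟨rfl, Sym2.out_fst_mem e⟩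
    obtain ⟨rfl, -⟩ := cons_mem_serverCons.1 hx
    exact ⟨rfl, serverCons_injective b h⟩
  · rintro ⟨rfl, rfl⟩; rfl

theorem serverCons_ne_cross {n : ℕ} {b : Bool} {e : Sym2 (BinString n)} {x y : BinString n} :
    serverCons b e ≠ s(BinString.cons false x, BinString.cons true y) := by
  intro h
  have h1 : BinString.cons false x ∈ serverCons b e := h ▸ Sym2.mem_mk_left _ _
  have h2 : BinString.cons true y ∈ serverCons b e := h ▸ Sym2.mem_mk_right _ _
  have := (cons_mem_serverCons.1 h1).1.trans (cons_mem_serverCons.1 h2).1.symm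
  cases this

theorem twoBits_eq (a b : Bool) :
    twoBits a b = BinString.cons a (BinString.cons b (Fin.elim0 : BinString 0)) := by
  funext i; fin_cases i <;> simp [twoBits, BinString.cons, Fin.snoc]

theorem exists_twoBits (x : BinString 2) : ∃ a b, x = twoBits a b :=
  ⟨x 1, x 0, by funext i; fin_cases i <;> rfl⟩

theorem twoBits_inj {a b c d : Bool} : twoBits a b = twoBits c d ↔ a = c ∧ b = d := by
  simp [twoBits_eq, BinString.cons_inj]

/-- The vertices of `B_n` are the edges of `CQ_n`. -/
theorem bcdcServers_eq_edgeSet (n : ℕ) (hn : 2 ≤ n) :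
    bcdcServers n = (crossedCube n).edgeSet := by
  induction n, hn using Nat.le_induction with
  | base =>
    have key : ∀ a b c d, (crossedCube 2).Adj (twoBits a b) (twoBits c d) ↔
        (a = c ∧ b ≠ d) ∨ (a ≠ c ∧ b = d) := by
      have h1 : ∀ b d, (crossedCube 1).Adj (BinString.cons b (Fin.elim0 : BinString 0))
          (BinString.cons d (Fin.elim0 : BinString 0)) ↔ b ≠ d := by
        intro b d; simp [crossedCube, BinString.cons_inj]
      have h2 : ∀ b d, CrossRelated (BinString.cons b (Fin.elim0 : BinString 0))
          (BinString.cons d (Fin.elim0 : BinString 0)) ↔ b = d := by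
        intro b d
        simp only [CrossRelated, BinString.cons]
        constructor
        · intro h; simpa [Fin.snoc] using h.1 (by decide) 0 rfl
        · rintro rfl; exact ⟨fun _ _ _ => rfl, fun i h => by omega⟩
      intro a b c d
      rw [twoBits_eq, twoBits_eq]
      cases a <;> cases c
      · rw [crossedCube_adj_same, h1]; simp
      · rw [crossedCube_adj_cross, h2]; simp
      · rw [SimpleGraph.adj_comm, crossedCube_adj_cross, h2]; simp [eq_comm]
      · rw [crossedCube_adj_same, h1]; simp
    ext e
    induction e using Sym2.ind with
    | _ x y =>
      obtain ⟨a, b, rfl⟩ := exists_twoBits x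
      obtain ⟨c, d, rfl⟩ := exists_twoBits y
      rw [SimpleGraph.mem_edgeSet, key]
      simp only [bcdcServers, Set.mem_insert_iff, Set.mem_singleton_iff, Sym2.eq_iff, twoBits_inj]
      revert a b c d; decide
  | succ n hn ih =>
    obtain ⟨n, rfl⟩ := Nat.exists_eq_add_of_le' hn
    ext e
    simp only [bcdcServers, ih, Set.mem_union, Set.mem_image]
    constructor
    · rintro ((⟨e, he, rfl⟩ | ⟨e, he, rfl⟩) | ⟨u, v, rfl, h⟩)
      · induction e using Sym2.ind with
        | _ x y => exact (crossedCube_adj_same false x y).2 he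
      · induction e using Sym2.ind with
        | _ x y => exact (crossedCube_adj_same true x y).2 he
      · exact h
    · induction e using Sym2.ind with
      | _ x y =>
        obtain ⟨a, u, rfl⟩ := BinString.exists_cons x
        obtain ⟨b, v, rfl⟩ := BinString.exists_cons y
        rw [SimpleGraph.mem_edgeSet]
        intro h
        cases a <;> cases b
        · exact Or.inl (Or.inl ⟨s(u, v), (crossedCube_adj_same _ u v).1 h, rfl⟩)
        · exact Or.inr ⟨u, v, rfl, h⟩
        · exact Or.inr ⟨v, u, Sym2.eq_swap, h.symm⟩
        · exact Or.inl (Or.inr ⟨s(u, v), (crossedCube_adj_same _ u v).1 h, rfl⟩)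

theorem bcdcLinks_adj_iff (n : ℕ) (hn : 2 ≤ n) :
    ∀ e ∈ bcdcServers n, ∀ f ∈ bcdcServers n,
      ((bcdcLinks n).Adj e f ↔ e ≠ f ∧ ∃ x, x ∈ e ∧ x ∈ f) := by
  induction n, hn using Nat.le_induction with
  | base =>
    simp only [bcdcServers, bcdcLinks, Set.mem_insert_iff, Set.mem_singleton_iff]
    rintro e (rfl | rfl | rfl | rfl) f (rfl | rfl | rfl | rfl) <;>
      simp [twoBits_inj]
  | succ n hn ih =>
    obtain ⟨n, rfl⟩ := Nat.exists_eq_add_of_le' hn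
    have same : ∀ b, ∀ e ∈ bcdcServers (n + 2), ∀ f ∈ bcdcServers (n + 2),
        ((bcdcLinks (n + 3)).Adj (serverCons b e) (serverCons b f) ↔
          serverCons b e ≠ serverCons b f ∧
            ∃ x, x ∈ serverCons b e ∧ x ∈ serverCons b f) := by
      intro b e he f hf
      have h1 : (∃ x, x ∈ serverCons b e ∧ x ∈ serverCons b f) ↔ ∃ x, x ∈ e ∧ x ∈ f := by
        constructor
        · rintro ⟨x, hx, hy⟩
          obtain ⟨u, hu, rfl⟩ := mem_serverCons.1 hx
          exact ⟨u, hu, (cons_mem_serverCons.1 hy).2⟩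
        · rintro ⟨x, hx, hy⟩
          exact ⟨_, cons_mem_serverCons.2 ⟨rfl, hx⟩, cons_mem_serverCons.2 ⟨rfl, hy⟩⟩
      have h2 : serverCons b e ≠ serverCons b f ↔ e ≠ f := (serverCons_injective b).ne_iff
      rw [h1, h2, ← ih e he f hf]
      simp only [bcdcLinks, SimpleGraph.fromRel_adj]
      constructor
      · rintro ⟨-, (⟨c, x, y, hx, hy, h⟩ | ⟨c, d, h, -⟩) | (⟨c, x, y, hx, hy, h⟩ | ⟨c, d, h, -⟩)⟩
        · rw [(serverCons_inj.1 hx).2, (serverCons_inj.1 hy).2]; exact h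
        · exact absurd h serverCons_ne_cross
        · rw [(serverCons_inj.1 hx).2, (serverCons_inj.1 hy).2]; exact h.symm
        · exact absurd h serverCons_ne_cross
      · intro h
        exact ⟨h2.2 h.ne, Or.inl (Or.inl ⟨b, e, f, rfl, rfl, h⟩)⟩
    have diff : ∀ e f : Sym2 (BinString (n + 2)),
        ((bcdcLinks (n + 3)).Adj (serverCons false e) (serverCons true f) ↔
          serverCons false e ≠ serverCons true f ∧
            ∃ x, x ∈ serverCons false e ∧ x ∈ serverCons true f) := by
      intro e f
      apply iff_of_false
      · simp only [bcdcLinks, SimpleGraph.fromRel_adj]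
        rintro ⟨-, (⟨c, x, y, hx, hy, h⟩ | ⟨c, d, h, -⟩) | (⟨c, x, y, hx, hy, h⟩ | ⟨c, d, h, -⟩)⟩
        · cases (serverCons_inj.1 hx).1.trans (serverCons_inj.1 hy).1.symm
        · exact serverCons_ne_cross h
        · cases (serverCons_inj.1 hx).1.trans (serverCons_inj.1 hy).1.symm
        · exact serverCons_ne_cross h
      · rintro ⟨-, x, hx, hy⟩
        obtain ⟨u, hu, rfl⟩ := mem_serverCons.1 hx
        cases (cons_mem_serverCons.1 hy).1
    have cross : ∀ b, ∀ e ∈ bcdcServers (n + 2), ∀ f ∈ crossServers (n + 2),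
        ((bcdcLinks (n + 3)).Adj (serverCons b e) f ↔
          serverCons b e ≠ f ∧ ∃ x, x ∈ serverCons b e ∧ x ∈ f) := by
      intro b e he f hf
      obtain ⟨u, v, rfl, -⟩ := id hf
      simp only [bcdcLinks, SimpleGraph.fromRel_adj]
      refine and_congr_right fun hne => ?_
      constructor
      · rintro ((⟨c, x, y, hx, hy, h⟩ | ⟨c, d, h, -, h'⟩) | (⟨c, x, y, hx, hy, h⟩ | ⟨c, d, h, -⟩))
        · exact absurd hy.symm serverCons_ne_cross
        · rcases h' with ⟨-, h'⟩ | ⟨-, h'⟩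
          · exact ⟨_, h', h ▸ Sym2.mem_mk_left _ _⟩
          · exact ⟨_, h', h ▸ Sym2.mem_mk_right _ _⟩
        · exact absurd hx.symm serverCons_ne_cross
        · exact absurd h serverCons_ne_cross
      · rintro ⟨x, hx, hy⟩
        refine Or.inl (Or.inr ⟨u, v, rfl, hf, ?_⟩)
        rcases Sym2.mem_iff.1 hy with rfl | rfl
        · obtain ⟨rfl, -⟩ := cons_mem_serverCons.1 hx
          exact Or.inl ⟨⟨e, he, rfl⟩, hx⟩
        · obtain ⟨rfl, -⟩ := cons_mem_serverCons.1 hx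
          exact Or.inr ⟨⟨e, he, rfl⟩, hx⟩
    have cc : ∀ e ∈ crossServers (n + 2), ∀ f ∈ crossServers (n + 2),
        ((bcdcLinks (n + 3)).Adj e f ↔ e ≠ f ∧ ∃ x, x ∈ e ∧ x ∈ f) := by
      rintro _ ⟨u, v, rfl, h⟩ _ ⟨u', v', rfl, h'⟩
      rw [crossedCube_adj_cross] at h h'
      apply iff_of_false
      · simp only [bcdcLinks, SimpleGraph.fromRel_adj]
        rintro ⟨-, (⟨c, x, y, hx, -⟩ | ⟨c, d, -, -, ⟨⟨e, -, he⟩, -⟩ | ⟨⟨e, -, he⟩, -⟩⟩) |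
          (⟨c, x, y, hx, -⟩ | ⟨c, d, -, -, ⟨⟨e, -, he⟩, -⟩ | ⟨⟨e, -, he⟩, -⟩⟩)⟩
        · exact serverCons_ne_cross hx.symm
        · exact serverCons_ne_cross he
        · exact serverCons_ne_cross he
        · exact serverCons_ne_cross hx.symm
        · exact serverCons_ne_cross he
        · exact serverCons_ne_cross he
      · rintro ⟨hne, x, hx, hy⟩
        apply hne
        rcases Sym2.mem_iff.1 hx with rfl | rfl <;> rcases Sym2.mem_iff.1 hy with hy | hy <;>
          obtain ⟨hb, rfl⟩ := BinString.cons_inj.1 hy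
        · rw [h.unique h']
        · cases hb
        · cases hb
        · rw [h.symm.unique h'.symm]
    have comm : ∀ e f, ((bcdcLinks (n + 3)).Adj e f ↔ e ≠ f ∧ ∃ x, x ∈ e ∧ x ∈ f) →
        ((bcdcLinks (n + 3)).Adj f e ↔ f ≠ e ∧ ∃ x, x ∈ f ∧ x ∈ e) := by
      intro e f h
      rw [SimpleGraph.adj_comm, h, ne_comm]
      simp only [and_comm]
    rintro e ((⟨e, he, rfl⟩ | ⟨e, he, rfl⟩) | he) f ((⟨f, hf, rfl⟩ | ⟨f, hf, rfl⟩) | hf)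
    · exact same _ e he f hf
    · exact diff e f
    · exact cross _ e he f hf
    · exact comm _ _ (diff f e)
    · exact same _ e he f hf
    · exact cross _ e he f hf
    · exact comm _ _ (cross _ f hf e he)
    · exact comm _ _ (cross _ f hf e he)
    · exact cc e he f hf

/-- `B_n` is the line graph of `CQ_n`. -/
def bcdcIsoLineGraph (n : ℕ) (hn : 2 ≤ n) : bcdc n ≃g (crossedCube n).lineGraph where
  toEquiv := Equiv.setCongr (bcdcServers_eq_edgeSet n hn)
  map_rel_iff' {e f} := by
    rw [SimpleGraph.lineGraph_adj_iff_exists, bcdc, SimpleGraph.comap_adj]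
    simp only [Function.Embedding.subtype_apply]
    rw [bcdcLinks_adj_iff n hn e.1 e.2 f.1 f.2]
    simp [Subtype.ext_iff]

/-! Both cases say that the connectivity is `2 * (n / 2)`. Since `B_n` is the line graph of `CQ_n`,
deleting copies of `K_{1,1}` means deleting edges of `CQ_n` in pairs that share an end; a
substructure may also be a single edge.

Upper bound: fix an edge `uv` of `CQ_n` and delete all other edges at `u` and at `v`. Then `uv` is
isolated in `B_n`, and some edge away from `u` and `v` survives. The `n - 1` edges deleted at one
end form a clique of `B_n`, so `⌈(n - 1) / 2⌉ = ⌊n / 2⌋` pairs cover them, two pairs overlapping if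
`n - 1` is odd.

Lower bound: let `t` families of at most two adjacent edges form a cut that disconnects `B_n`. Let
`A` be the set of ends of the edges in one remaining component. Every edge leaving `A` is deleted,
so at most `2t` edges leave `A`, and both `A` and its complement contain an edge of `CQ_n`. If both
have at least three vertices, isoperimetry (`two_mul_sub_one_le_card_edgeBoundary`) gives `2n - 1 ≤
2t`, hence `t ≥ n`. If one of them is just an edge `uv`, then no family meets both the other edges
at `u` and those at `v`, because `CQ_n` has no triangles; each end thus needs its own `⌊n / 2⌋`
families (`le_card_of_cover_around_edge`). A cut that leaves a single vertex must delete all edges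
of `CQ_n` but one, which costs even more.

Isoperimetry, regularity and the absence of triangles all come from one description: `CQ_{n+1}` is
two copies of `CQ_n` joined by the perfect matching `crossMate`. -/

/-! ### Crossed cubes: matching, regularity, triangles -/

/-- The string that is cross-related to `u`: `v_{2i} = u_{2i}` and `v_{2i+1} = u_{2i+1} + u_{2i}`. -/
def crossMate {m : ℕ} (u : BinString m) : BinString m := fun j =>
  if j.val % 2 = 1 then xor (u j) (u ⟨j.val - 1, by omega⟩) else u j

theorem crossRelated_crossMate {m : ℕ} (u : BinString m) : CrossRelated u (crossMate u) := by
  refine ⟨fun he i hi => ?_, fun i hi => ?_⟩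
  -- For `m + 1` even, the leading index `m - 1` is even, and the mate keeps the bits at even
  -- indices.
  · have h : ¬ i.val % 2 = 1 := by rw [Nat.even_iff] at he; omega
    simp [crossMate, h]
  · have h1 : (2 * i + 1) % 2 = 1 := by omega
    have h0 : ¬ (2 * i) % 2 = 1 := by omega
    simp only [crossMate, h1, h0, if_true, if_false, Nat.add_sub_cancel]
    generalize u ⟨2 * i + 1, hi⟩ = a
    generalize u ⟨2 * i, _⟩ = b
    cases a <;> cases b <;> simp [PairRelated]

theorem crossRelated_iff {m : ℕ} {u v : BinString m} : CrossRelated u v ↔ v = crossMate u :=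
  ⟨fun h => h.unique (crossRelated_crossMate u), fun h => h ▸ crossRelated_crossMate u⟩

theorem crossMate_crossMate {m : ℕ} (u : BinString m) : crossMate (crossMate u) = u :=
  (crossRelated_iff.1 (crossRelated_crossMate u).symm).symm

theorem crossMate_injective {m : ℕ} : Function.Injective (crossMate (m := m)) :=
  Function.LeftInverse.injective crossMate_crossMate

/-- The placeholder `CQ_0`, a single isolated vertex, makes the recursive description valid for
`CQ_1` too, so later inductions can start at `0`. -/
theorem crossedCube_adj_cons_same {n : ℕ} (b : Bool) (u v : BinString n) :
    (crossedCube (n + 1)).Adj (BinString.cons b u) (BinString.cons b v) ↔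
      (crossedCube n).Adj u v := by
  cases n with
  | zero =>
    have h : u = v := Subsingleton.elim _ _
    simp [h]
  | succ n => exact crossedCube_adj_same b u v

theorem crossedCube_adj_cons_not {n : ℕ} (b : Bool) (u v : BinString n) :
    (crossedCube (n + 1)).Adj (BinString.cons b u) (BinString.cons (!b) v) ↔
      v = crossMate u := by
  cases n with
  | zero =>
    have h : v = crossMate u := Subsingleton.elim _ _
    simp only [crossedCube, SimpleGraph.top_adj, ne_eq, BinString.cons_inj, h]
    cases b <;> simp
  | succ n =>
    cases b
    · exact (crossedCube_adj_cross u v).trans crossRelated_iff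
    · rw [SimpleGraph.adj_comm]
      refine (crossedCube_adj_cross v u).trans ?_
      rw [← crossRelated_iff]
      exact ⟨CrossRelated.symm, CrossRelated.symm⟩

theorem BinString.cons_left_injective {n : ℕ} (b : Bool) :
    Function.Injective (BinString.cons (n := n) b) := fun _ _ h => (BinString.cons_inj.1 h).2

theorem crossedCube_neighborSet_cons {n : ℕ} (b : Bool) (u : BinString n) :
    (crossedCube (n + 1)).neighborSet (BinString.cons b u) =
      insert (BinString.cons (!b) (crossMate u))
        (BinString.cons b '' (crossedCube n).neighborSet u) := by
  ext y
  obtain ⟨c, v, rfl⟩ := BinString.exists_cons y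
  simp only [SimpleGraph.mem_neighborSet, Set.mem_insert_iff, Set.mem_image]
  rcases Bool.eq_or_eq_not c b with rfl | rfl
  · simp [crossedCube_adj_cons_same, BinString.cons_inj]
  · simp [crossedCube_adj_cons_not, BinString.cons_inj]

theorem crossedCube_ncard_neighborSet (n : ℕ) (u : BinString n) :
    ((crossedCube n).neighborSet u).ncard = n := by
  induction n with
  | zero => simp [crossedCube, SimpleGraph.neighborSet]
  | succ n ih =>
    obtain ⟨b, u, rfl⟩ := BinString.exists_cons u
    rw [crossedCube_neighborSet_cons, Set.ncard_insert_of_notMem,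
      Set.ncard_image_of_injective _ (BinString.cons_left_injective b), ih]
    rintro ⟨v, -, h⟩
    simpa using (BinString.cons_inj.1 h).1

/-- A triangle meeting both copies would have two vertices in one copy matched to the same vertex of
the other. -/
theorem crossedCube_not_triangle (n : ℕ) {x y z : BinString n} (hxy : (crossedCube n).Adj x y)
    (hyz : (crossedCube n).Adj y z) (hxz : (crossedCube n).Adj x z) : False := by
  induction n with
  | zero => exact hxy
  | succ n ih =>
    have key : ∀ (b : Bool) (u v w : BinString n),
        (crossedCube (n + 1)).Adj (BinString.cons b u) (BinString.cons b v) →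
        (crossedCube (n + 1)).Adj (BinString.cons b u) (BinString.cons (!b) w) →
        (crossedCube (n + 1)).Adj (BinString.cons b v) (BinString.cons (!b) w) → False := by
      intro b u v w h h1 h2
      rw [crossedCube_adj_cons_not] at h1 h2
      rw [crossMate_injective (h1.symm.trans h2)] at h
      exact h.ne rfl
    obtain ⟨a, u, rfl⟩ := BinString.exists_cons x
    obtain ⟨b, v, rfl⟩ := BinString.exists_cons y
    obtain ⟨c, w, rfl⟩ := BinString.exists_cons z
    rcases Bool.eq_or_eq_not b a with rfl | rfl
    · rcases Bool.eq_or_eq_not c b with rfl | rfl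
      · rw [crossedCube_adj_cons_same] at hxy hyz hxz
        exact ih hxy hyz hxz
      · exact key _ _ _ _ hxy hxz hyz
    · rcases Bool.eq_or_eq_not c a with rfl | rfl
      · exact key _ _ _ _ hxz hxy hyz.symm
      · exact key (!a) v w u hyz (by simpa using hxy.symm) (by simpa using hxz.symm)

/-! ### Edge boundaries in crossed cubes -/

open scoped Classical in
/-- The edges of `CQ_n` that leave `A`, oriented away from `A`. -/
noncomputable def edgeBoundary {n : ℕ} (A : Finset (BinString n)) :
    Finset (BinString n × BinString n) :=
  Finset.univ.filter fun p => p.1 ∈ A ∧ p.2 ∉ A ∧ (crossedCube n).Adj p.1 p.2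

theorem mem_edgeBoundary {n : ℕ} {A : Finset (BinString n)} {p : BinString n × BinString n} :
    p ∈ edgeBoundary A ↔ p.1 ∈ A ∧ p.2 ∉ A ∧ (crossedCube n).Adj p.1 p.2 := by
  simp [edgeBoundary]

/-- The strings `u` for which `bu` lies in `A`. -/
def consFiber {n : ℕ} (b : Bool) (A : Finset (BinString (n + 1))) : Finset (BinString n) :=
  Finset.univ.filter fun u => BinString.cons b u ∈ A

theorem mem_consFiber {n : ℕ} {b : Bool} {A : Finset (BinString (n + 1))} {u : BinString n} :
    u ∈ consFiber b A ↔ BinString.cons b u ∈ A := by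
  simp [consFiber]

theorem card_binString (n : ℕ) : Fintype.card (BinString n) = 2 ^ n := by simp [BinString]

theorem card_consFiber_add {n : ℕ} (A : Finset (BinString (n + 1))) :
    (consFiber false A).card + (consFiber true A).card = A.card := by
  rw [← Finset.card_image_of_injective _ (BinString.cons_left_injective false),
    ← Finset.card_image_of_injective (consFiber true A) (BinString.cons_left_injective true),
    ← Finset.card_union_of_disjoint]
  · congr 1
    ext x
    obtain ⟨b, u, rfl⟩ := BinString.exists_cons x
    cases b <;> simp [BinString.cons_inj, mem_consFiber]
  · rw [Finset.disjoint_left]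
    simp only [Finset.mem_image, not_exists, not_and]
    rintro _ ⟨u, -, rfl⟩ v - h
    cases (BinString.cons_inj.1 h).1

/-- The boundary of `A` contains the boundaries of its two halves and the matching edges from one
half to vertices outside the other. The subtraction is truncated; taking both values of `b` yields
the absolute difference of the sizes. -/
theorem card_edgeBoundary_consFiber_le {n : ℕ} (b : Bool) (A : Finset (BinString (n + 1))) :
    (edgeBoundary (consFiber b A)).card + (edgeBoundary (consFiber (!b) A)).card +
      ((consFiber b A).card - (consFiber (!b) A).card) ≤ (edgeBoundary A).card := by
  set f : Bool → BinString n × BinString n → BinString (n + 1) × BinString (n + 1) :=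
    fun c p => (BinString.cons c p.1, BinString.cons c p.2) with hf
  set g : BinString n → BinString (n + 1) × BinString (n + 1) :=
    fun u => (BinString.cons b u, BinString.cons (!b) (crossMate u)) with hg
  have hfi : ∀ c, Function.Injective (f c) := by
    intro c p q h
    simp only [hf, Prod.mk.injEq, BinString.cons_inj, true_and] at h
    exact Prod.ext h.1 h.2
  have hgi : Function.Injective g := by
    intro p q h
    simp only [hg, Prod.mk.injEq, BinString.cons_inj, true_and] at h
    exact h.1
  -- The vertices of one half whose mates lie outside `A`; `g` sends each to its matching edge.
  set D := consFiber b A \ (consFiber (!b) A).image crossMate with hD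
  have hDc : (consFiber b A).card - (consFiber (!b) A).card ≤ D.card := by
    refine le_trans ?_ (Finset.le_card_sdiff _ _)
    rw [Finset.card_image_of_injective _ crossMate_injective]
  have hsub : (edgeBoundary (consFiber b A)).image (f b) ∪
      (edgeBoundary (consFiber (!b) A)).image (f (!b)) ∪ D.image g ⊆ edgeBoundary A := by
    intro p hp
    simp only [Finset.mem_union, Finset.mem_image, mem_edgeBoundary, mem_consFiber, hD,
      Finset.mem_sdiff] at hp
    rw [mem_edgeBoundary]
    rcases hp with (⟨q, ⟨h1, h2, h3⟩, rfl⟩ | ⟨q, ⟨h1, h2, h3⟩, rfl⟩) | ⟨u, ⟨h1, h2⟩, rfl⟩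
    · exact ⟨h1, h2, (crossedCube_adj_cons_same _ _ _).2 h3⟩
    · exact ⟨h1, h2, (crossedCube_adj_cons_same _ _ _).2 h3⟩
    · refine ⟨h1, fun h => h2 ⟨_, h, crossMate_crossMate u⟩,
        (crossedCube_adj_cons_not _ _ _).2 rfl⟩
  refine le_trans ?_ (Finset.card_le_card hsub)
  rw [Finset.card_union_of_disjoint, Finset.card_union_of_disjoint,
    Finset.card_image_of_injective _ (hfi _), Finset.card_image_of_injective _ (hfi _),
    Finset.card_image_of_injective _ hgi]
  · omega
  · rw [Finset.disjoint_left]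
    simp only [Finset.mem_image, not_exists, not_and]
    rintro _ ⟨u, -, rfl⟩ v - h
    have := (BinString.cons_inj.1 (congrArg Prod.fst h)).1
    simp at this
  · rw [Finset.disjoint_left]
    simp only [Finset.mem_image, not_exists, not_and, Finset.mem_union]
    rintro _ (⟨u, -, rfl⟩ | ⟨u, -, rfl⟩) v - h
    · have := (BinString.cons_inj.1 (congrArg Prod.snd h)).1
      simp at this
    · have := (BinString.cons_inj.1 (congrArg Prod.fst h)).1
      simp at this

theorem card_binString_finset_le {n : ℕ} (A : Finset (BinString n)) : A.card ≤ 2 ^ n :=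
  card_binString n ▸ A.card_le_univ

/-- If both halves are nonempty and proper, they give `2n ≥ n + 1`. Otherwise one half is empty or
full: either the other gives `n` and the matching at least one more, or it is of the opposite kind
and the matching gives `2 ^ n > n`. -/
theorem le_card_edgeBoundary (n : ℕ) (A : Finset (BinString n)) (h1 : 0 < A.card)
    (h2 : A.card < 2 ^ n) : n ≤ (edgeBoundary A).card := by
  induction n with
  | zero => omega
  | succ n ih =>
    have e0 := card_edgeBoundary_consFiber_le false A
    have e1 := card_edgeBoundary_consFiber_le true A
    have ha := card_consFiber_add A
    have i0 := ih (consFiber false A)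
    have i1 := ih (consFiber true A)
    have b0 := card_binString_finset_le (consFiber false A)
    have b1 := card_binString_finset_le (consFiber true A)
    have hp : n < 2 ^ n := Nat.lt_two_pow_self
    have hz : n = 0 → 2 ^ n = 1 := by rintro rfl; rfl
    simp only [Bool.not_false, Bool.not_true] at e0 e1
    rw [pow_succ] at h2
    omega

/-- Two nonempty proper halves give `n` each by the previous bound. If one half is empty, the other
gives `2n - 2` by induction and the matching at least two more, unless it misses at most one vertex;
then the matching edges are numerous enough. A full half is symmetric. -/
theorem two_mul_sub_two_le_card_edgeBoundary (n : ℕ) (A : Finset (BinString n))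
    (h1 : 2 ≤ A.card) (h2 : A.card + 2 ≤ 2 ^ n) : 2 * n - 2 ≤ (edgeBoundary A).card := by
  induction n with
  | zero => omega
  | succ n ih =>
    have e0 := card_edgeBoundary_consFiber_le false A
    have e1 := card_edgeBoundary_consFiber_le true A
    have ha := card_consFiber_add A
    have i0 := ih (consFiber false A)
    have i1 := ih (consFiber true A)
    have j0 := le_card_edgeBoundary n (consFiber false A)
    have j1 := le_card_edgeBoundary n (consFiber true A)
    have b0 := card_binString_finset_le (consFiber false A)
    have b1 := card_binString_finset_le (consFiber true A)
    have hp : n < 2 ^ n := Nat.lt_two_pow_self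
    have hp' : 2 * n ≤ 2 ^ n := by
      rcases n with _ | n
      · simp
      · have : n < 2 ^ n := Nat.lt_two_pow_self
        rw [pow_succ]; omega
    simp only [Bool.not_false, Bool.not_true] at e0 e1
    rw [pow_succ] at h2
    omega

/-- One more than the previous bound, so that halving it rounds up to `n`. With `n + 1` for the
dimension, two nonempty proper halves of different sizes give `2n` and a matching edge. Halves of
equal size have at least two vertices and miss at least two, giving `2 * (2n - 2) ≥ 2n + 1`. If a
half is empty or full, the matching supplies the surplus. In dimension 3 the bound fails: only four
edges leave a copy of `CQ_2`. -/
theorem two_mul_sub_one_le_card_edgeBoundary (n : ℕ) (hn : 4 ≤ n) (A : Finset (BinString n))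
    (h1 : 3 ≤ A.card) (h2 : A.card + 3 ≤ 2 ^ n) : 2 * n - 1 ≤ (edgeBoundary A).card := by
  obtain ⟨n, rfl⟩ : ∃ k, n = k + 1 := ⟨n - 1, by omega⟩
  have e0 := card_edgeBoundary_consFiber_le false A
  have e1 := card_edgeBoundary_consFiber_le true A
  have ha := card_consFiber_add A
  have i0 := two_mul_sub_two_le_card_edgeBoundary n (consFiber false A)
  have i1 := two_mul_sub_two_le_card_edgeBoundary n (consFiber true A)
  have j0 := le_card_edgeBoundary n (consFiber false A)
  have j1 := le_card_edgeBoundary n (consFiber true A)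
  have b0 := card_binString_finset_le (consFiber false A)
  have b1 := card_binString_finset_le (consFiber true A)
  have hp : 2 * n + 1 ≤ 2 ^ n := by
    have : ∀ k, 2 * (k + 3) + 1 ≤ 2 ^ (k + 3) := by
      intro k
      induction k with
      | zero => norm_num
      | succ k ih => rw [show k + 1 + 3 = (k + 3) + 1 from rfl, pow_succ]; omega
    obtain ⟨k, rfl⟩ : ∃ k, n = k + 3 := ⟨n - 3, by omega⟩
    exact this k
  simp only [Bool.not_false, Bool.not_true] at e0 e1
  rw [pow_succ] at h2
  omega

/-! ### Covering an edge boundary by small families of adjacent edges -/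

theorem ncard_neighborSet_diff_singleton {n : ℕ} {u v : BinString n}
    (h : (crossedCube n).Adj u v) : ((crossedCube n).neighborSet u \ {v}).ncard = n - 1 := by
  rw [Set.ncard_sdiff_singleton_of_mem ((SimpleGraph.mem_neighborSet _ _ _).2 h), crossedCube_ncard_neighborSet]

theorem card_le_two_mul_card_of_cover {α ι : Type*} [DecidableEq α] (E : Finset α)
    (T : Finset ι) (p : ι → Finset α) (h2 : ∀ t ∈ T, (p t).card ≤ 2)
    (h : ∀ e ∈ E, ∃ t ∈ T, e ∈ p t) : E.card ≤ 2 * T.card := by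
  have hsub : E ⊆ T.biUnion p := fun e he => Finset.mem_biUnion.2 (h e he)
  have := (Finset.card_le_card hsub).trans (Finset.card_biUnion_le_card_mul T p 2 h2)
  omega

section Cover

variable {n : ℕ} {ι : Type*} (T : Finset ι) (p : ι → Finset (Sym2 (BinString n)))

theorem card_edgeBoundary_le_of_cover (h2 : ∀ t ∈ T, (p t).card ≤ 2)
    (A : Finset (BinString n))
    (hcov : ∀ x ∈ A, ∀ y ∉ A, (crossedCube n).Adj x y → ∃ t ∈ T, s(x, y) ∈ p t) :
    (edgeBoundary A).card ≤ 2 * T.card := by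
  -- Only one orientation of an edge can leave `A`, so forgetting orientations loses nothing.
  have hinj : Set.InjOn (fun q : BinString n × BinString n => s(q.1, q.2))
      (edgeBoundary A : Set (BinString n × BinString n)) := by
    intro q hq r hr h
    have hq := mem_edgeBoundary.1 hq
    have hr := mem_edgeBoundary.1 hr
    rcases Sym2.eq_iff.1 h with ⟨h1, h2⟩ | ⟨h1, h2⟩
    · exact Prod.ext h1 h2
    · exact absurd (h1 ▸ hq.1) hr.2.1
  rw [← Finset.card_image_of_injOn hinj]
  refine card_le_two_mul_card_of_cover _ T p h2 ?_
  intro e he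
  obtain ⟨q, hq, rfl⟩ := Finset.mem_image.1 he
  have hq := mem_edgeBoundary.1 hq
  exact hcov _ hq.1 _ hq.2.1 hq.2.2

/-- Edges at `u` and edges at `v` other than `uv` cannot be in the same family, so the edges
around `uv` take `⌈(n - 1) / 2⌉` families on each side. -/
theorem le_card_of_cover_around_edge (h2 : ∀ t ∈ T, (p t).card ≤ 2)
    (hadj : ∀ t ∈ T, ∀ e ∈ p t, ∀ f ∈ p t, ∃ x, x ∈ e ∧ x ∈ f) {u v : BinString n}
    (huv : (crossedCube n).Adj u v)
    (hu : ∀ y, y ≠ v → (crossedCube n).Adj u y → ∃ t ∈ T, s(u, y) ∈ p t)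
    (hv : ∀ y, y ≠ u → (crossedCube n).Adj v y → ∃ t ∈ T, s(v, y) ∈ p t) :
    2 * (n / 2) ≤ T.card := by
  classical
  have key : ∀ u v : BinString n, (crossedCube n).Adj u v →
      (∀ y, y ≠ v → (crossedCube n).Adj u y → ∃ t ∈ T, s(u, y) ∈ p t) →
      n / 2 ≤ (T.filter fun t => ∃ y, y ≠ v ∧ (crossedCube n).Adj u y ∧ s(u, y) ∈ p t).card := by
    intro u v huv hu
    have hinj : Function.Injective fun y : BinString n => s(u, y) := fun y z h =>
      Sym2.congr_right.1 h
    have h1 := card_le_two_mul_card_of_cover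
      (((crossedCube n).neighborSet u \ {v}).toFinset.image fun y => s(u, y))
      (T.filter fun t => ∃ y, y ≠ v ∧ (crossedCube n).Adj u y ∧ s(u, y) ∈ p t) p
      (fun t ht => h2 t (Finset.mem_filter.1 ht).1) (by
        intro e he
        obtain ⟨y, hy, rfl⟩ := Finset.mem_image.1 he
        obtain ⟨hy1, hy2⟩ := Set.mem_toFinset.1 hy
        obtain ⟨t, ht, hty⟩ := hu y hy2 hy1
        exact ⟨t, Finset.mem_filter.2 ⟨ht, y, hy2, hy1, hty⟩, hty⟩)
    -- The count is `n - 1 ≤ 2 * card`, and `⌈(n - 1) / 2⌉ = ⌊n / 2⌋`.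
    rw [Finset.card_image_of_injective _ hinj, ← Set.ncard_eq_toFinset_card',
      ncard_neighborSet_diff_singleton huv] at h1
    omega
  have k1 := key u v huv hu
  have k2 := key v u huv.symm hv
  have hle := Finset.card_le_card (Finset.union_subset
    (Finset.filter_subset (fun t => ∃ y, y ≠ v ∧ (crossedCube n).Adj u y ∧ s(u, y) ∈ p t) T)
    (Finset.filter_subset (fun t => ∃ y, y ≠ u ∧ (crossedCube n).Adj v y ∧ s(v, y) ∈ p t) T))
  rw [Finset.card_union_of_disjoint] at hle
  · omega
  rw [Finset.disjoint_left]
  intro t ht ht'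
  obtain ⟨htT, y, hy, huy, hy'⟩ := Finset.mem_filter.1 ht
  obtain ⟨-, z, hz, hvz, hz'⟩ := Finset.mem_filter.1 ht'
  obtain ⟨x, hx, hx'⟩ := hadj t htT _ hy' _ hz'
  -- A common end of `uy` and `vz` could only be `y = z`, which closes a triangle.
  rcases Sym2.mem_iff.1 hx with rfl | rfl <;> rcases Sym2.mem_iff.1 hx' with h | h
  · exact huv.ne h
  · exact hz h.symm
  · exact hy h
  · subst h
    exact crossedCube_not_triangle n huv hvz huy

theorem le_card_of_cover_edgeBoundary (hn : 4 ≤ n) (h2 : ∀ t ∈ T, (p t).card ≤ 2)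
    (hadj : ∀ t ∈ T, ∀ e ∈ p t, ∀ f ∈ p t, ∃ x, x ∈ e ∧ x ∈ f) (A : Finset (BinString n))
    (hA : ∃ x ∈ A, ∃ y ∈ A, (crossedCube n).Adj x y)
    (hA' : ∃ x ∉ A, ∃ y ∉ A, (crossedCube n).Adj x y)
    (hcov : ∀ x ∈ A, ∀ y ∉ A, (crossedCube n).Adj x y → ∃ t ∈ T, s(x, y) ∈ p t) :
    2 * (n / 2) ≤ T.card := by
  have small : ∀ B : Finset (BinString n), (∃ x ∈ B, ∃ y ∈ B, (crossedCube n).Adj x y) →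
      (∀ x ∈ B, ∀ y ∉ B, (crossedCube n).Adj x y → ∃ t ∈ T, s(x, y) ∈ p t) →
      B.card ≤ 2 → 2 * (n / 2) ≤ T.card := by
    rintro B ⟨u, hu, v, hv, huv⟩ hB hc
    have hBe : {u, v} = B := by
      refine Finset.eq_of_subset_of_card_le ?_ ?_
      · simp [Finset.insert_subset_iff, hu, hv]
      · rw [Finset.card_pair huv.ne]; exact hc
    refine le_card_of_cover_around_edge T p h2 hadj huv ?_ ?_
    · intro y hy huy
      exact hB u hu y (by rw [← hBe]; simp [hy, huy.ne']) huy
    · intro y hy hvy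
      exact hB v hv y (by rw [← hBe]; simp [hy, hvy.ne']) hvy
  by_cases c1 : A.card ≤ 2
  · exact small A hA hcov c1
  by_cases c2 : Aᶜ.card ≤ 2
  · refine small Aᶜ (by simpa using hA') ?_ c2
    intro x hx y hy hxy
    rw [Sym2.eq_swap]
    exact hcov y (by simpa using hy) x (by simpa using hx) hxy.symm
  rw [Finset.card_compl, card_binString] at c2
  have h3 := two_mul_sub_one_le_card_edgeBoundary n hn A (by omega) (by omega)
  have h4 := card_edgeBoundary_le_of_cover T p h2 A hcov
  omega

/-- This serves the cuts that leave one vertex. By regularity `CQ_n` has `n * 2 ^ (n - 1) ≥ 2n`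
edges; dropping one leaves at least `2n - 1`, which need `n` families. -/
theorem le_card_of_cover_edgeSet (hn : 4 ≤ n) (h2 : ∀ t ∈ T, (p t).card ≤ 2)
    (e : Sym2 (BinString n))
    (hcov : ∀ f ∈ (crossedCube n).edgeSet, f ≠ e → ∃ t ∈ T, f ∈ p t) : n ≤ T.card := by
  classical
  have h1 := card_le_two_mul_card_of_cover ((crossedCube n).edgeFinset.erase e) T p h2 (by
    intro f hf
    obtain ⟨h, h'⟩ := Finset.mem_erase.1 hf
    exact hcov f (SimpleGraph.mem_edgeFinset.1 h') h)
  have h3 := (crossedCube n).sum_degrees_eq_twice_card_edges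
  have h4 : ∀ x, (crossedCube n).degree x = n := by
    intro x
    rw [← SimpleGraph.card_neighborSet_eq_degree, ← Set.toFinset_card,
      ← Set.ncard_eq_toFinset_card', crossedCube_ncard_neighborSet]
  simp only [h4, Finset.sum_const, Finset.card_univ, card_binString, smul_eq_mul] at h3
  have h5 := Finset.pred_card_le_card_erase (a := e) (s := (crossedCube n).edgeFinset)
  have h6 : n < 2 ^ n := Nat.lt_two_pow_self
  have h7 : 4 * n ≤ 2 ^ n * n := Nat.mul_le_mul_right n (by omega)
  omega

end Cover

/-! ### The lower bound -/

theorem bcdc_adj_iff {n : ℕ} (hn : 2 ≤ n) (e f : bcdcServers n) :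
    (bcdc n).Adj e f ↔ e ≠ f ∧ ∃ x, x ∈ e.1 ∧ x ∈ f.1 := by
  rw [bcdc, SimpleGraph.comap_adj]
  refine (bcdcLinks_adj_iff n hn e.1 e.2 f.1 f.2).trans ?_
  simp [Subtype.ext_iff]

theorem SimpleGraph.Subgraph.card_verts_le_two_of_substructure {V : Type*} {G : SimpleGraph V}
    {K : G.Subgraph} (h : ∃ H' : (completeBipartiteGraph (Fin 1) (Fin 1)).Subgraph,
      H'.Connected ∧ Nonempty (K.coe ≃g H'.coe)) :
    K.verts.encard ≤ 2 ∧ ∀ a ∈ K.verts, ∀ b ∈ K.verts, a ≠ b → G.Adj a b := by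
  obtain ⟨H', hH, ⟨i⟩⟩ := h
  have hc : K.verts.encard ≤ 2 := by
    rw [Set.encard_congr i.toEquiv]
    refine (Set.encard_le_encard (Set.subset_univ _)).trans ?_
    simp [Set.encard_univ]
  refine ⟨hc, fun a ha b hb hab => ?_⟩
  have hK : K.coe.Preconnected := i.preconnected_iff.2 hH.coe.preconnected
  have : Nontrivial K.verts := ⟨⟨a, ha⟩, ⟨b, hb⟩, fun h => hab (congrArg Subtype.val h)⟩
  -- Connectedness gives `a` a neighbour in `K`; were it not `b`, `K` would have three vertices.
  obtain ⟨⟨c, hcK⟩, hac⟩ := hK.exists_adj_of_nontrivial ⟨a, ha⟩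
  have hac' : K.Adj a c := hac
  suffices c = b from this ▸ hac'.adj_sub
  by_contra hcb
  have : ({a, b, c} : Set V).encard ≤ 2 :=
    (Set.encard_le_encard (by rintro x (rfl | rfl | rfl) <;> assumption)).trans hc
  rw [Set.encard_insert_of_notMem (by simp [hab, hac'.ne]),
    Set.encard_pair (Ne.symm hcb)] at this
  norm_num at this

theorem le_encard_of_isSubstructureCut {n : ℕ} (hn : 4 ≤ n) (F : Set (bcdc n).Subgraph)
    (hF : IsSubstructureCut (bcdc n) (completeBipartiteGraph (Fin 1) (Fin 1)) F) :
    ((2 * (n / 2) : ℕ) : ℕ∞) ≤ F.encard := by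
  classical
  have hn2 : 2 ≤ n := by omega
  have hmem : ∀ {x y : BinString n}, s(x, y) ∈ bcdcServers n ↔ (crossedCube n).Adj x y := by
    intro x y
    rw [bcdcServers_eq_edgeSet n hn2, SimpleGraph.mem_edgeSet]
  rcases F.finite_or_infinite with hfin | hinf
  swap
  · rw [hinf.encard_eq]; exact le_top
  rw [hfin.encard_eq_coe_toFinset_card, Nat.cast_le]
  obtain ⟨hcut, hpieces⟩ := hF
  obtain ⟨p, hp⟩ : ∃ p : (bcdc n).Subgraph → Finset (Sym2 (BinString n)),
      ∀ K, (p K : Set (Sym2 (BinString n))) = Subtype.val '' K.verts :=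
    ⟨fun K => (Set.toFinite (Subtype.val '' K.verts)).toFinset, fun K => by simp⟩
  have hpmem : ∀ K (e : bcdcServers n), e ∈ K.verts → e.1 ∈ p K := by
    intro K e he
    rw [← Finset.mem_coe, hp]
    exact Set.mem_image_of_mem _ he
  have h2 : ∀ K ∈ hfin.toFinset, (p K).card ≤ 2 := by
    intro K hK
    have := (SimpleGraph.Subgraph.card_verts_le_two_of_substructure
      (hpieces K (hfin.mem_toFinset.1 hK))).1
    rw [← Subtype.val_injective.encard_image, ← hp, Set.encard_coe_eq_coe_finsetCard] at this
    exact_mod_cast this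
  have hadj : ∀ K ∈ hfin.toFinset, ∀ e ∈ p K, ∀ f ∈ p K, ∃ x, x ∈ e ∧ x ∈ f := by
    intro K hK e he f hf
    rw [← Finset.mem_coe, hp] at he hf
    obtain ⟨e, he, rfl⟩ := he
    obtain ⟨f, hf, rfl⟩ := hf
    by_cases hef : e = f
    · subst hef
      exact ⟨e.1.out.1, Sym2.out_fst_mem _, Sym2.out_fst_mem _⟩
    · exact ((bcdc_adj_iff hn2 e f).1 ((SimpleGraph.Subgraph.card_verts_le_two_of_substructure
        (hpieces K (hfin.mem_toFinset.1 hK))).2 e he f hf hef)).2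
  have hcovered : ∀ e : bcdcServers n, e ∈ coveredVerts F → ∃ K ∈ hfin.toFinset, e.1 ∈ p K := by
    intro e he
    obtain ⟨K, hK, heK⟩ := Set.mem_iUnion₂.1 he
    exact ⟨K, hfin.mem_toFinset.2 hK, hpmem K e heK⟩
  rcases hcut with hdis | ⟨e, he⟩
  · obtain ⟨e, f, hef⟩ : ∃ e f, ¬ ((bcdc n).induce (coveredVerts F)ᶜ).Reachable e f := by
      simpa [SimpleGraph.Preconnected] using hdis
    set G' := (bcdc n).induce (coveredVerts F)ᶜ with hG'
    have step : ∀ g h : ((coveredVerts F)ᶜ : Set (bcdcServers n)), G'.Reachable e g →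
        (∃ x, x ∈ g.1.1 ∧ x ∈ h.1.1) → G'.Reachable e h := by
      intro g h hg hx
      by_cases hgh : g = h
      · exact hgh ▸ hg
      · refine hg.trans (SimpleGraph.Adj.reachable ?_)
        exact (bcdc_adj_iff hn2 g.1 h.1).2 ⟨fun h' => hgh (Subtype.ext h'), hx⟩
    have ends : ∀ g : bcdcServers n, ∃ x y, g.1 = s(x, y) ∧ (crossedCube n).Adj x y := by
      rintro ⟨g, hg⟩
      induction g using Sym2.ind with
      | _ x y => exact ⟨x, y, rfl, hmem.1 hg⟩
    -- `A` consists of the ends of the surviving servers in the component of `e`. It contains the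
    -- ends of `e` but neither end of `f`, and a surviving server with one end in `A` has both
    -- there.
    refine le_card_of_cover_edgeBoundary hfin.toFinset p hn h2 hadj
      (Finset.univ.filter fun x => ∃ g, G'.Reachable e g ∧ x ∈ g.1.1) ?_ ?_ ?_
    · obtain ⟨x, y, hxy, had⟩ := ends e.1
      refine ⟨x, ?_, y, ?_, had⟩ <;> rw [Finset.mem_filter] <;>
        exact ⟨Finset.mem_univ _, e, SimpleGraph.Reachable.refl _, by simp [hxy]⟩
    · obtain ⟨x, y, hxy, had⟩ := ends f.1
      refine ⟨x, ?_, y, ?_, had⟩ <;> rw [Finset.mem_filter] <;> rintro ⟨-, g, hg, hx⟩ <;>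
        exact hef (step g f hg ⟨_, hx, by simp [hxy]⟩)
    · intro x hx y hy had
      obtain ⟨-, g, hg, hxg⟩ := Finset.mem_filter.1 hx
      apply hcovered ⟨s(x, y), hmem.2 had⟩
      by_contra hunc
      refine hy (Finset.mem_filter.2 ⟨Finset.mem_univ _, ⟨⟨s(x, y), hmem.2 had⟩, hunc⟩, ?_, by simp⟩)
      exact step g _ hg ⟨x, hxg, by simp⟩
  · have := le_card_of_cover_edgeSet hfin.toFinset p hn h2 e.1 (by
      intro f hf hfe
      rw [← bcdcServers_eq_edgeSet n hn2] at hf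
      apply hcovered ⟨f, hf⟩
      by_contra hunc
      have : (⟨f, hf⟩ : bcdcServers n) ∈ (coveredVerts F)ᶜ := hunc
      rw [he] at this
      exact hfe (congrArg Subtype.val this))
    omega

/-! ### The upper bound -/

/-- Pairs must consist of distinct elements, since a structure cut admits no single vertices; an odd
set is therefore covered with an overlap. Pairs are split off only while at least four elements
remain, so that at least two are always left. -/
theorem Finset.exists_pair_cover {α : Type*} [DecidableEq α] (k : ℕ) (S : Finset α)
    (h2 : 2 ≤ S.card) (hk : S.card ≤ 2 * k) :
    ∃ P : Finset (α × α), P.card ≤ k ∧ (∀ q ∈ P, q.1 ∈ S ∧ q.2 ∈ S ∧ q.1 ≠ q.2) ∧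
      ∀ x ∈ S, ∃ q ∈ P, x = q.1 ∨ x = q.2 := by
  induction k generalizing S with
  | zero => omega
  | succ k ih =>
    rcases Nat.lt_or_ge S.card 4 with hlt | hge
    · obtain h | h : S.card = 2 ∨ S.card = 3 := by omega
      · obtain ⟨a, b, hab, rfl⟩ := Finset.card_eq_two.1 h
        exact ⟨{(a, b)}, by simp, by simp [hab], by simp⟩
      · obtain ⟨a, b, c, hab, hac, hbc, rfl⟩ := Finset.card_eq_three.1 h
        refine ⟨{(a, b), (b, c)}, Finset.card_le_two.trans (by omega), by simp [hab, hbc], ?_⟩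
        simp
    · obtain ⟨a, ha, b, hb, hab⟩ := Finset.one_lt_card.1 (show 1 < S.card by omega)
      have hc : ((S.erase a).erase b).card = S.card - 2 := by
        rw [Finset.card_erase_of_mem (Finset.mem_erase.2 ⟨hab.symm, hb⟩),
          Finset.card_erase_of_mem ha]
        omega
      obtain ⟨P, hP, hP1, hP2⟩ := ih ((S.erase a).erase b) (by omega) (by omega)
      refine ⟨insert (a, b) P, (Finset.card_insert_le _ _).trans (by omega), ?_, ?_⟩
      · intro q hq
        rcases Finset.mem_insert.1 hq with rfl | hq
        · exact ⟨ha, hb, hab⟩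
        · obtain ⟨h1, h2, h3⟩ := hP1 q hq
          exact ⟨Finset.mem_of_mem_erase (Finset.mem_of_mem_erase h1),
            Finset.mem_of_mem_erase (Finset.mem_of_mem_erase h2), h3⟩
      · intro x hx
        by_cases hxa : x = a
        · exact ⟨(a, b), by simp, Or.inl hxa⟩
        by_cases hxb : x = b
        · exact ⟨(a, b), by simp, Or.inr hxb⟩
        obtain ⟨q, hq, h⟩ := hP2 x (by simp [hxa, hxb, hx])
        exact ⟨q, Finset.mem_insert_of_mem hq, h⟩

theorem SimpleGraph.nonempty_subgraphOfAdj_iso {V : Type*} {G : SimpleGraph V} {a b : V}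
    (h : G.Adj a b) :
    Nonempty ((G.subgraphOfAdj h).coe ≃g completeBipartiteGraph (Fin 1) (Fin 1)) := by
  classical
  have ha : a ∈ (G.subgraphOfAdj h).verts := by simp
  have hb : b ∈ (G.subgraphOfAdj h).verts := by simp
  let e : (G.subgraphOfAdj h).verts ≃ Fin 1 ⊕ Fin 1 :=
    { toFun := fun x => if x.1 = a then Sum.inl 0 else Sum.inr 0
      invFun := Sum.elim (fun _ => ⟨a, ha⟩) (fun _ => ⟨b, hb⟩)
      left_inv := by
        rintro ⟨x, rfl | rfl⟩
        · simp
        · simp [h.ne']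
      right_inv := by
        rintro (x | x)
        · simp [Subsingleton.elim x 0]
        · simp [Subsingleton.elim x 0, h.ne'] }
  refine ⟨⟨e, ?_⟩⟩
  rintro ⟨x, rfl | rfl⟩ ⟨y, rfl | rfl⟩ <;> simp [e, h.ne, h.ne']

theorem exists_edge_family_of_isClique {V : Type*} {G : SimpleGraph V} (k : ℕ) (S : Set V)
    (hS : G.IsClique S) (h2 : 2 ≤ S.ncard) (hk : S.ncard ≤ 2 * k) :
    ∃ F : Set G.Subgraph, F.encard ≤ k ∧
      (∀ K ∈ F, Nonempty (K.coe ≃g completeBipartiteGraph (Fin 1) (Fin 1))) ∧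
      coveredVerts F = S := by
  classical
  have hfin : S.Finite := Set.finite_of_ncard_pos (by omega)
  lift S to Finset V using hfin
  rw [Set.ncard_coe_finset] at h2 hk
  obtain ⟨P, hP, hP1, hP2⟩ := S.exists_pair_cover k h2 hk
  have hadj : ∀ q ∈ P, G.Adj q.1 q.2 := fun q hq =>
    hS (hP1 q hq).1 (hP1 q hq).2.1 (hP1 q hq).2.2
  -- The value `⊥` only makes the map total; all pairs in `P` are adjacent.
  refine ⟨(fun q : V × V => if h : G.Adj q.1 q.2 then G.subgraphOfAdj h else ⊥) '' P, ?_, ?_, ?_⟩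
  · refine (Set.encard_image_le _ _).trans ?_
    rw [Set.encard_coe_eq_coe_finsetCard]
    exact_mod_cast hP
  · rintro _ ⟨q, hq, rfl⟩
    have h := hadj q hq
    beta_reduce
    rw [dif_pos h]
    exact SimpleGraph.nonempty_subgraphOfAdj_iso h
  · ext x
    simp only [coveredVerts, Set.mem_iUnion, exists_prop, Set.exists_mem_image]
    constructor
    · rintro ⟨q, hq, hx⟩
      simp only [hadj q hq, dif_pos] at hx
      rcases hx with rfl | rfl
      · exact (hP1 q hq).1
      · exact (hP1 q hq).2.1
    · intro hx
      obtain ⟨q, hq, h⟩ := hP2 x hx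
      refine ⟨q, hq, ?_⟩
      simp only [hadj q hq, dif_pos]
      exact h

theorem exists_crossedCube_adj_ne {n : ℕ} (hn : 2 ≤ n) (u v : BinString n) :
    ∃ w, w ≠ v ∧ (crossedCube n).Adj u w := by
  obtain ⟨w, hw, hwv⟩ := Set.exists_ne_of_one_lt_ncard
    (s := (crossedCube n).neighborSet u) (by rw [crossedCube_ncard_neighborSet]; omega) v
  exact ⟨w, hwv, hw⟩

/-- The servers other than `[u, v]` that contain `u`. -/
def serversAt {n : ℕ} (u v : BinString n) : Set (bcdcServers n) :=
  {e | u ∈ e.1 ∧ e.1 ≠ s(u, v)}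

theorem ncard_serversAt {n : ℕ} (hn : 2 ≤ n) {u v : BinString n}
    (huv : (crossedCube n).Adj u v) : (serversAt u v).ncard = n - 1 := by
  have hinj : Function.Injective fun y : BinString n => s(u, y) := fun y z h =>
    Sym2.congr_right.1 h
  rw [← Set.ncard_image_of_injective _ Subtype.val_injective,
    ← ncard_neighborSet_diff_singleton huv, ← Set.ncard_image_of_injective _ hinj]
  congr 1
  ext e
  constructor
  · rintro ⟨⟨e, he⟩, ⟨h1, h2⟩, rfl⟩
    obtain ⟨y, rfl⟩ := Sym2.mem_iff_exists.1 h1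
    rw [bcdcServers_eq_edgeSet n hn, SimpleGraph.mem_edgeSet] at he
    exact ⟨y, ⟨he, fun h => h2 (congrArg (fun a => s(u, a)) h)⟩, rfl⟩
  · rintro ⟨y, ⟨hy, hyv⟩, rfl⟩
    refine ⟨⟨s(u, y), ?_⟩, ⟨by simp, fun h => hyv (hinj h)⟩, rfl⟩
    rw [bcdcServers_eq_edgeSet n hn]
    exact hy

theorem exists_isStructureCut_bcdc {n : ℕ} (hn : 3 ≤ n) :
    ∃ F : Set (bcdc n).Subgraph,
      IsStructureCut (bcdc n) (completeBipartiteGraph (Fin 1) (Fin 1)) F ∧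
        F.encard ≤ (2 * (n / 2) : ℕ) := by
  have hn2 : 2 ≤ n := by omega
  have hmem : ∀ {x y : BinString n}, (crossedCube n).Adj x y → s(x, y) ∈ bcdcServers n := by
    intro x y h
    rwa [bcdcServers_eq_edgeSet n hn2, SimpleGraph.mem_edgeSet]
  have clique : ∀ u v : BinString n, (bcdc n).IsClique (serversAt u v) := by
    intro u v e he f hf hef
    exact (bcdc_adj_iff hn2 e f).2 ⟨hef, u, he.1, hf.1⟩
  set u : BinString n := fun _ => false
  obtain ⟨v, -, huv⟩ := exists_crossedCube_adj_ne hn2 u u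
  obtain ⟨F, hF, hFi, hFc⟩ := exists_edge_family_of_isClique (n / 2) _ (clique u v)
    (by rw [ncard_serversAt hn2 huv]; omega) (by rw [ncard_serversAt hn2 huv]; omega)
  obtain ⟨F', hF', hFi', hFc'⟩ := exists_edge_family_of_isClique (n / 2) _ (clique v u)
    (by rw [ncard_serversAt hn2 huv.symm]; omega) (by rw [ncard_serversAt hn2 huv.symm]; omega)
  have hcov : coveredVerts (F ∪ F') = serversAt u v ∪ serversAt v u := by
    rw [← hFc, ← hFc', coveredVerts, Set.biUnion_union]
    rfl
  refine ⟨F ∪ F', ⟨Or.inl ?_, ?_⟩, ?_⟩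
  · rw [hcov]
    -- A path `u`, `w`, `z` with `w ≠ v` and `z ≠ u`: since there are no triangles, `z ≠ v`, so `wz`
    -- avoids `u` and `v` and survives.
    obtain ⟨w, hwv, huw⟩ := exists_crossedCube_adj_ne hn2 u v
    obtain ⟨z, hzu, hwz⟩ := exists_crossedCube_adj_ne hn2 w u
    have hzv : z ≠ v := by
      rintro rfl
      exact crossedCube_not_triangle n huw hwz huv
    have h1 : (⟨s(u, v), hmem huv⟩ : bcdcServers n) ∈ (serversAt u v ∪ serversAt v u)ᶜ := by
      rintro (h | h)
      · exact h.2 rfl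
      · exact h.2 Sym2.eq_swap
    have h2 : (⟨s(w, z), hmem hwz⟩ : bcdcServers n) ∈ (serversAt u v ∪ serversAt v u)ᶜ := by
      rintro (h | h)
      · rcases Sym2.mem_iff.1 h.1 with h | h
        · exact huw.ne h
        · exact hzu h.symm
      · rcases Sym2.mem_iff.1 h.1 with h | h
        · exact hwv h.symm
        · exact hzv h.symm
    intro hpre
    have hne : (⟨_, h1⟩ : ((serversAt u v ∪ serversAt v u)ᶜ : Set (bcdcServers n))) ≠ ⟨_, h2⟩ := by
      intro h
      have h' : s(u, v) = s(w, z) := congrArg (fun e => e.1.1) h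
      have hu : u ∈ s(w, z) := h' ▸ Sym2.mem_mk_left u v
      rcases Sym2.mem_iff.1 hu with h | h
      · exact huw.ne h
      · exact hzu h.symm
    have : Nontrivial ((serversAt u v ∪ serversAt v u)ᶜ : Set (bcdcServers n)) := ⟨_, _, hne⟩
    -- If the rest were connected, `uv` would have a surviving neighbour, but every other server at
    -- `u` or `v` is deleted.
    obtain ⟨g, hg⟩ := hpre.exists_adj_of_nontrivial ⟨_, h1⟩
    obtain ⟨hne, x, hx, hxg⟩ := (bcdc_adj_iff hn2 _ g.1).1 hg
    have hne' : g.1.1 ≠ s(u, v) := fun h => hne (Subtype.ext h.symm)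
    rcases Sym2.mem_iff.1 hx with rfl | rfl
    · exact g.2 (Or.inl ⟨hxg, hne'⟩)
    · exact g.2 (Or.inr ⟨hxg, fun h => hne' (h.trans Sym2.eq_swap)⟩)
  · rintro K (hK | hK)
    · exact hFi K hK
    · exact hFi' K hK
  · refine (Set.encard_union_le _ _).trans ((add_le_add hF hF').trans ?_)
    rw [two_mul, Nat.cast_add]

theorem SimpleGraph.completeBipartiteGraph_fin_one_connected :
    (completeBipartiteGraph (Fin 1) (Fin 1)).Connected := by
  have h : (completeBipartiteGraph (Fin 1) (Fin 1)).Adj (Sum.inl 0) (Sum.inr 0) := by simp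
  have key : ∀ x, (completeBipartiteGraph (Fin 1) (Fin 1)).Reachable (Sum.inl 0) x := by
    rintro (x | x)
    · rw [Subsingleton.elim x 0]
    · rw [Subsingleton.elim x 0]
      exact h.reachable
  exact { preconnected := fun x y => (key x).symm.trans (key y), nonempty := ⟨Sum.inl 0⟩ }

theorem IsStructureCut.isSubstructureCut {V W : Type*} {G : SimpleGraph V} {H : SimpleGraph W}
    {F : Set G.Subgraph} (hH : H.Connected) (h : IsStructureCut G H F) :
    IsSubstructureCut G H F := by
  refine ⟨h.1, fun K hK => ⟨⊤, ?_, ?_⟩⟩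
  · rw [SimpleGraph.Subgraph.connected_iff']
    exact (SimpleGraph.Subgraph.topIso.connected_iff).2 hH
  · obtain ⟨i⟩ := h.2 K hK
    exact ⟨i.trans SimpleGraph.Subgraph.topIso.symm⟩

/-- Every structure cut is a substructure cut, so one structure cut and the lower bound for
substructure cuts settle both equalities. -/
theorem bcdc_connectivity_edge {n : ℕ} (hn : 4 ≤ n) :
    structureConnectivity (bcdc n) (completeBipartiteGraph (Fin 1) (Fin 1)) =
        ((2 * (n / 2) : ℕ) : ℕ∞) ∧
      substructureConnectivity (bcdc n) (completeBipartiteGraph (Fin 1) (Fin 1)) =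
        ((2 * (n / 2) : ℕ) : ℕ∞) := by
  obtain ⟨F, hF, hc⟩ := exists_isStructureCut_bcdc (n := n) (by omega)
  have hsub := fun {F : Set (bcdc n).Subgraph} =>
    IsStructureCut.isSubstructureCut (F := F) SimpleGraph.completeBipartiteGraph_fin_one_connected
  refine ⟨le_antisymm (le_trans (sInf_le ?_) hc) (le_sInf ?_),
    le_antisymm (le_trans (sInf_le ?_) hc) (le_sInf ?_)⟩
  · exact ⟨F, hF, rfl⟩
  · rintro _ ⟨F', hF', rfl⟩
    exact le_encard_of_isSubstructureCut hn F' (hsub hF')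
  · exact ⟨F, hsub hF, rfl⟩
  · rintro _ ⟨F', hF', rfl⟩
    exact le_encard_of_isSubstructureCut hn F' hF'

theorem theorem4p5 (n : ℕ) :
    (Odd n → 5 ≤ n →
      structureConnectivity (bcdc n) (completeBipartiteGraph (Fin 1) (Fin 1)) = ((n - 1 : ℕ) : ℕ∞) ∧
      substructureConnectivity (bcdc n) (completeBipartiteGraph (Fin 1) (Fin 1)) =
        ((n - 1 : ℕ) : ℕ∞)) ∧
    (Even n → 4 ≤ n →
      structureConnectivity (bcdc n) (completeBipartiteGraph (Fin 1) (Fin 1)) = (n : ℕ∞) ∧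
      substructureConnectivity (bcdc n) (completeBipartiteGraph (Fin 1) (Fin 1)) = (n : ℕ∞)) := by
  refine ⟨fun ho hn => ?_, fun he hn => ?_⟩
  · have h : n - 1 = 2 * (n / 2) := by rw [Nat.odd_iff] at ho; omega
    rw [h]
    exact bcdc_connectivity_edge (by omega)
  · have h := bcdc_connectivity_edge hn
    rwa [Nat.two_mul_div_two_of_even he] at h
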